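/- Let $\mathbb B$ be a compact smooth manifold with boundary, $\dim\mathbb B=n+1$, $n\ge 0$, with a fixed collar neighbourhood $[0,1)\times\partial\mathbb B$ of the boundary with coordinates $(x,y)$. A cut-off function is a function $0\le\omega\in C_c^\infty([0,1))$ with $\omega=1$ near $0$; $\omega=\omega(x)$ is regarded as a function on $\mathbb B$ vanishing outside the collar. For $s,\gamma\in\mathbb R$ and $1\le p<\infty$ let $H^s_p(\mathbb R^{n+1})$ be the Bessel potential space, and define $H^s_{p,loc}(\operatorname{Int}\mathbb B)$ and $H^s_p(\mathbb R\times\partial\mathbb B)$ from it by localization, the first with a smooth atlas of $\operatorname{Int}\mathbb B$ and smooth compactly supported functions in the chart domains, the second with a finite smooth atlas of $\partial\mathbb B$ and a subordinate partition of unity. The cone Sobolev space $\mathcal H^{s,\gamma}_p(\mathbb B)$ consists of all distributions $u\in H^s_{p,loc}(\operatorname{Int}\mathbb B)$ such that for every cut-off function $\omega$ $$S_\gamma(\omega u)\in H^s_p(\mathbb R\times\partial\mathbb B),\qquad (S_\gamma v)(r,y)=e^{(\gamma-\frac{n+1}2)r}\,v(e^{-r},y).$$ For a fixed cut-off function $\omega$,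 its norm $\|u\|_{\mathcal H^{s,\gamma}_p(\mathbb B)}$ is the sum of the norm of $S_\gamma(\omega u)$ in $H^s_p(\mathbb R\times\partial\mathbb B)$ and of the $H^s_p$-norm of $(1-\omega)u$, computed with a finite family of smooth functions that sum to $1-\omega$ on $\operatorname{Int}\mathbb B$, each compactly supported in the domain of a chart of the chosen atlas of $\operatorname{Int}\mathbb B$. Let $1\le p<\infty$, $s>(n+1)/p$ and $\gamma\in\mathbb R$. Then, for all such choices of atlases, partition of unity and norm, there are constants $c\ge0$ and $\delta\in(0,1)$ such that every $u\in\mathcal H^{s,\gamma}_p(\mathbb B)$ is (given by) a continuous function on $\operatorname{Int}\mathbb B$ and satisfies $$|u(x,y)|\le c\,x^{\gamma-\frac{n+1}2}\,\|u\|_{\mathcal H^{s,\gamma}_p(\mathbb B)}\qquad\text{for all }0<x<\delta,\ y\in\partial\mathbb B .$$ In particular, if $\gamma>(n+1)/2$, then $u(x,y)\to0$ as $x\to0^+$, uniformly in $y\in\partial\mathbb B$. -/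

import Mathlib

open scoped Manifold ContDiff ENNReal Distributions SchwartzMap Topology
open MeasureTheory Set Filter

noncomputable section

namespace ConeSobolev

/-- Euclidean space of dimension `d`, with its Euclidean norm. -/
abbrev E (d : ℕ) : Type := EuclideanSpace ℝ (Fin d)

/-- The point `(r, z)` of `ℝ × ℝⁿ`, regarded as a point of `ℝⁿ⁺¹`. -/
def consE {n : ℕ} (r : ℝ) (z : E n) : E (n + 1) :=
  WithLp.toLp 2 (Fin.cons r (fun i => z i) : Fin (n + 1) → ℝ)

/-- The projection `(r, z) ↦ z` from `ℝⁿ⁺¹ = ℝ × ℝⁿ` to `ℝⁿ`. -/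
def tailE {n : ℕ} (w : E (n + 1)) : E n :=
  WithLp.toLp 2 (fun i : Fin n => w i.succ)

@[simp] theorem consE_zero {n : ℕ} (r : ℝ) (z : E n) : consE r z 0 = r := by
  simp [consE]

@[simp] theorem tailE_consE {n : ℕ} (r : ℝ) (z : E n) : tailE (consE r z) = z := by
  ext i; simp [consE, tailE]

@[simp] theorem consE_tailE {n : ℕ} (w : E (n + 1)) : consE (w 0) (tailE w) = w := by
  ext i
  refine Fin.cases ?_ (fun j => ?_) i <;> simp [consE, tailE]

theorem contDiff_consE {n : ℕ} : ContDiff ℝ ∞ (fun q : ℝ × E n => consE q.1 q.2) := by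
  rw [contDiff_euclidean]
  intro i
  refine Fin.cases ?_ (fun j => ?_) i
  · simpa [consE] using contDiff_fst
  · simp only [consE, Fin.cons_succ]
    fun_prop

theorem contDiff_tailE {n : ℕ} : ContDiff ℝ ∞ (tailE : E (n + 1) → E n) := by
  rw [contDiff_euclidean]
  intro i
  simp only [tailE]
  fun_prop

section Manifold

variable (n : ℕ) (B : Type*) [TopologicalSpace B] [ChartedSpace (EuclideanHalfSpace (n + 1)) B]

/-- A smooth chart of the interior of the `(n+1)`-dimensional manifold with boundary `B`: a smooth
diffeomorphism from an open subset of `Int B` onto an open subset of `ℝⁿ⁺¹`. -/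
structure InteriorChart extends OpenPartialHomeomorph B (E (n + 1)) where
  source_subset : source ⊆ (𝓡∂ (n + 1)).interior B
  smooth : ContMDiffOn (𝓡∂ (n + 1)) (𝓡 (n + 1)) ∞ toFun source
  smooth_symm : ContMDiffOn (𝓡 (n + 1)) (𝓡∂ (n + 1)) ∞ invFun target

variable {n B}

/-- The range of a chart, as an open subset of `ℝⁿ⁺¹`. -/
def InteriorChart.range (e : InteriorChart n B) : TopologicalSpace.Opens (E (n + 1)) :=
  ⟨e.target, e.open_target⟩

/-- The transition map from the chart `e` to the chart `e'`, defined on an open subset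
of `ℝⁿ⁺¹`. -/
def InteriorChart.transition (e e' : InteriorChart n B) :
    OpenPartialHomeomorph (E (n + 1)) (E (n + 1)) :=
  e.toOpenPartialHomeomorph.symm.trans e'.toOpenPartialHomeomorph

variable (n B)

/-- A complex-valued (generalized-function type) distribution on `Int B`: a family of
distributions `u_e ∈ 𝓓'(e(U))`, one for every chart `e : U → e(U) ⊆ ℝⁿ⁺¹` of `Int B`, which
transform like functions under a change of charts `τ = e' ∘ e⁻¹`, that is, `u_e = τ^* u_{e'}` on
the overlap: `u_e (|det Dτ| (η' ∘ τ)) = u_{e'} (η')` for all test functions `η'` supported in the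
overlap. -/
structure InteriorDistribution where
  toFun : ∀ e : InteriorChart n B, 𝓓'(e.range, ℂ)
  compat : ∀ (e e' : InteriorChart n B) (η : 𝓓(e.range, ℝ)) (η' : 𝓓(e'.range, ℝ)),
    tsupport η ⊆ (e.transition e').source →
    tsupport η' ⊆ (e.transition e').target →
    (∀ z ∈ (e.transition e').source,
      η z = |(fderiv ℝ (e.transition e') z).det| * η' (e.transition e' z)) →
    toFun e η = toFun e' η'

variable {n B}

/-- The distribution `u` is given by the function `f` on `Int B`. -/
def InteriorDistribution.IsGivenBy (u : InteriorDistribution n B) (f : B → ℂ) : Prop :=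
  ∀ (e : InteriorChart n B) (η : 𝓓(e.range, ℝ)),
    u.toFun e η = ∫ z in (e.range : Set (E (n + 1))), (η z : ℂ) * f (e.symm z)

/-- `T` is the product `w · u_e` of the weight `w` with the representation `u_e` of `u` in the
chart `e`, extended by zero to a tempered distribution on `ℝⁿ⁺¹`. It is used for weights `w` that
are smooth on the range of `e` and such that `w · g` has compact support in the range of `e` for
every `g ∈ C_c^∞(ℝⁿ⁺¹)`; then `T` is unique, since `C_c^∞(ℝⁿ⁺¹)` is dense in the Schwartz
space. -/
def IsWeightedLocalization (u : InteriorDistribution n B) (e : InteriorChart n B)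
    (w : E (n + 1) → ℝ) (T : 𝓢'(E (n + 1), ℂ)) : Prop :=
  ∀ g : 𝓢(E (n + 1), ℂ), HasCompactSupport g → ∀ η : 𝓓(e.range, ℝ),
    (∀ z ∈ e.range, (η z : ℂ) = (w z : ℂ) * g z) → T g = u.toFun e η

/-- `w · u_e`, extended by zero, belongs to the Bessel potential space `H^s_p(ℝⁿ⁺¹)`. -/
def MemSobolevInChart (s : ℝ) (p : ℝ≥0∞) [Fact (1 ≤ p)] (u : InteriorDistribution n B)
    (e : InteriorChart n B) (w : E (n + 1) → ℝ) : Prop :=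
  ∃ T : 𝓢'(E (n + 1), ℂ), IsWeightedLocalization u e w T ∧ TemperedDistribution.MemSobolev s p T

/-- The norm of `w · u_e`, extended by zero, in the Bessel potential space `H^s_p(ℝⁿ⁺¹)`. When
`w · u_e` is in this space, the infimum is taken over a single number. -/
def sobolevNormInChart (s : ℝ) (p : ℝ≥0∞) [Fact (1 ≤ p)] (u : InteriorDistribution n B)
    (e : InteriorChart n B) (w : E (n + 1) → ℝ) : ℝ :=
  sInf {a : ℝ | ∃ (T : 𝓢'(E (n + 1), ℂ)) (f : Lp ℂ p (volume : Measure (E (n + 1)))),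
    IsWeightedLocalization u e w T ∧
    TemperedDistribution.besselPotential (E (n + 1)) ℂ s T = f ∧ a = ‖f‖}

variable (n B) (Y : Type*) [TopologicalSpace Y] [ChartedSpace (E n) Y]

/-- A collar of the boundary of `B`: a diffeomorphism, smooth up to `x = 0`, from `[0,1) × Y` onto
an open neighbourhood of `∂B`, which maps `{0} × Y` onto `∂B`. Thus `Y` is a copy of the
boundary `∂B`, and the points near the boundary have coordinates `(x, y)`. -/
structure Collar extends PartialEquiv (ℝ × Y) B where
  source_eq : source = Ico (0 : ℝ) 1 ×ˢ (univ : Set Y)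
  open_target : IsOpen target
  smooth : ContMDiffOn (𝓘(ℝ, ℝ).prod (𝓡 n)) (𝓡∂ (n + 1)) ∞ toFun source
  smooth_symm : ContMDiffOn (𝓡∂ (n + 1)) (𝓘(ℝ, ℝ).prod (𝓡 n)) ∞ invFun target
  image_zero : toFun '' ({(0 : ℝ)} ×ˢ (univ : Set Y)) = (𝓡∂ (n + 1)).boundary B

variable {n B Y}

/-- The point of `B` with collar coordinates `(x, y)`. -/
def Collar.point (C : Collar n B Y) (x : ℝ) (y : Y) : B := C.toPartialEquiv (x, y)

theorem Collar.mem_source (C : Collar n B Y) {x : ℝ} {y : Y} :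
    (x, y) ∈ C.source ↔ 0 ≤ x ∧ x < 1 := by
  rw [C.source_eq]; simp

theorem exp_neg_mem {r : ℝ} (hr : 0 < r) : 0 ≤ Real.exp (-r) ∧ Real.exp (-r) < 1 :=
  ⟨(Real.exp_pos _).le, by simpa using hr⟩

/-- The first collar coordinate vanishes only on the boundary. -/
theorem Collar.mem_interior (C : Collar n B Y) {b : B}
    (hx : 0 < (C.toPartialEquiv.symm b).1) : b ∈ (𝓡∂ (n + 1)).interior B := by
  rw [← ModelWithCorners.compl_boundary, mem_compl_iff, ← C.image_zero]
  rintro ⟨⟨x, y⟩, ⟨hx0, -⟩, hq⟩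
  have h0 : x = 0 := hx0
  have hs : (x, y) ∈ C.source := C.mem_source.2 (by simp [h0])
  have := C.left_inv hs
  rw [hq] at this
  have h1 : (C.toPartialEquiv.symm b).1 = x := congrArg Prod.fst this
  rw [h1, h0] at hx
  exact lt_irrefl _ hx

/-- For a smooth chart `κ` of `Y`, the chart `(x, y) ↦ (r, κ y)`, `x = e^{-r}`, of `Int B`, defined
on the part `(0,1) × dom κ` of the collar. -/
def Collar.logChart (C : Collar n B Y) (κ : OpenPartialHomeomorph Y (E n))
    (hκ : κ ∈ IsManifold.maximalAtlas (𝓡 n) ∞ Y) : InteriorChart n B :=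
  have hsm : ContMDiffOn (𝓡∂ (n + 1)) (𝓡 (n + 1)) ∞
      (fun b => consE (-Real.log (C.toPartialEquiv.symm b).1) (κ (C.toPartialEquiv.symm b).2))
      (C.target ∩ C.toPartialEquiv.symm ⁻¹' (Ioi (0 : ℝ) ×ˢ κ.source)) := by
    have h0 := C.smooth_symm.mono
      (inter_subset_left (t := C.toPartialEquiv.symm ⁻¹' (Ioi (0 : ℝ) ×ˢ κ.source)))
    have h1 := (contMDiff_fst (I := 𝓘(ℝ, ℝ)) (J := 𝓡 n) (M := ℝ) (N := Y)
      (n := ∞)).comp_contMDiffOn h0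
    have h2 := (contMDiff_snd (I := 𝓘(ℝ, ℝ)) (J := 𝓡 n) (M := ℝ) (N := Y)
      (n := ∞)).comp_contMDiffOn h0
    have hl : ContMDiffOn 𝓘(ℝ, ℝ) 𝓘(ℝ, ℝ) ∞ (fun x : ℝ => -Real.log x) (Ioi 0) :=
      (((Real.contDiffOn_log (n := ∞)).mono (fun x (hx : 0 < x) => hx.ne')).neg).contMDiffOn
    have h3 := hl.comp h1 (fun b hb => hb.2.1)
    have h4 := (contMDiffOn_of_mem_maximalAtlas hκ).comp h2 (fun b hb => hb.2.2)
    exact (contDiff_consE (n := n)).contMDiff.comp_contMDiffOn (h3.prodMk_space h4)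
  have hsm' : ContMDiffOn (𝓡 (n + 1)) (𝓡∂ (n + 1)) ∞
      (fun z : E (n + 1) => C.point (Real.exp (-z 0)) (κ.symm (tailE z)))
      {z | 0 < z 0 ∧ tailE z ∈ κ.target} := by
    have h1 : ContMDiff (𝓡 (n + 1)) 𝓘(ℝ, ℝ) ∞ (fun z : E (n + 1) => Real.exp (-z 0)) := by
      have : ContDiff ℝ ∞ (fun z : E (n + 1) => Real.exp (-z 0)) := by fun_prop
      exact this.contMDiff
    have h2 : ContMDiffOn (𝓡 (n + 1)) (𝓡 n) ∞ (fun z : E (n + 1) => κ.symm (tailE z))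
        {z | 0 < z 0 ∧ tailE z ∈ κ.target} :=
      (contMDiffOn_symm_of_mem_maximalAtlas hκ).comp
        (contDiff_tailE (n := n)).contMDiff.contMDiffOn (fun z hz => hz.2)
    exact C.smooth.comp (h1.contMDiffOn.prodMk h2)
      (fun z hz => C.mem_source.2 (exp_neg_mem hz.1))
  { toFun := fun b =>
      consE (-Real.log (C.toPartialEquiv.symm b).1) (κ (C.toPartialEquiv.symm b).2)
    invFun := fun z => C.point (Real.exp (-z 0)) (κ.symm (tailE z))
    source := C.target ∩ C.toPartialEquiv.symm ⁻¹' (Ioi (0 : ℝ) ×ˢ κ.source)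
    target := {z | 0 < z 0 ∧ tailE z ∈ κ.target}
    map_source' := by
      rintro b ⟨hb, hx, hy⟩
      have h1 : (C.toPartialEquiv.symm b).1 < 1 := (C.mem_source.1 (C.map_target hb)).2
      refine ⟨?_, ?_⟩
      · rw [consE_zero]
        exact neg_pos.2 (Real.log_neg hx h1)
      · rw [tailE_consE]
        exact κ.map_source hy
    map_target' := by
      rintro z ⟨hz, hz'⟩
      have hs : (Real.exp (-z 0), κ.symm (tailE z)) ∈ C.source := C.mem_source.2 (exp_neg_mem hz)
      refine ⟨C.map_source hs, ?_⟩
      rw [mem_preimage, Collar.point, C.left_inv hs]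
      exact ⟨Real.exp_pos _, κ.map_target hz'⟩
    left_inv' := by
      rintro b ⟨hb, hx, hy⟩
      simp only [consE_zero, tailE_consE, neg_neg]
      rw [Real.exp_log hx, κ.left_inv hy]
      exact C.right_inv hb
    right_inv' := by
      rintro z ⟨hz, hz'⟩
      have hs : (Real.exp (-z 0), κ.symm (tailE z)) ∈ C.source := C.mem_source.2 (exp_neg_mem hz)
      simp only [Collar.point]
      rw [C.left_inv hs]
      simp only [Real.log_exp, neg_neg]
      rw [κ.right_inv hz', consE_tailE]
    open_source := C.smooth_symm.continuousOn.isOpen_inter_preimage C.open_target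
      (isOpen_Ioi.prod κ.open_source)
    open_target := (isOpen_Ioi.preimage (by fun_prop : Continuous fun z : E (n + 1) => z 0)).inter
      (κ.open_target.preimage contDiff_tailE.continuous)
    continuousOn_toFun := hsm.continuousOn
    continuousOn_invFun := hsm'.continuousOn
    source_subset := fun b hb => C.mem_interior hb.2.1
    smooth := hsm
    smooth_symm := hsm' }

/-- Cut-off functions near `x = 0`, that is, `0 ≤ θ ∈ C_c^∞([0,1))` with `θ = 1` near `x = 0`. The
function is continued to the real line by `1` on the left and by `0` on the right. -/
structure IsCutoff (θ : ℝ → ℝ) : Prop where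
  smooth : ContDiff ℝ ∞ θ
  nonneg : ∀ x, 0 ≤ θ x
  eq_one : ∃ ε > 0, ∀ x ≤ ε, θ x = 1
  eq_zero : ∃ δ < 1, ∀ x ≥ δ, θ x = 0

/-- The function `θ(x)` on `B`, extended by zero outside the collar. -/
def Collar.cutoff (C : Collar n B Y) (θ : ℝ → ℝ) (b : B) : ℝ := by
  classical
  exact if b ∈ C.target then θ (C.toPartialEquiv.symm b).1 else 0

/-- The choices that enter the definition of Sobolev spaces by localization: a finite smooth atlas
of `Y` with a subordinate partition of unity, a smooth atlas of `Int B`, a cut-off function `θ`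
near the boundary, and a finite family of smooth functions, each one compactly supported in the
domain of a chart of `Int B`, with sum `1 - θ`. The last two are used for the norm only. -/
structure LocalizationData (C : Collar n B Y) where
  ι : Type
  fintype_ι : Fintype ι
  bdryChart : ι → OpenPartialHomeomorph Y (E n)
  bdryChart_mem : ∀ i, bdryChart i ∈ IsManifold.maximalAtlas (𝓡 n) ∞ Y
  part : ι → Y → ℝ
  part_smooth : ∀ i, ContMDiff (𝓡 n) 𝓘(ℝ, ℝ) ∞ (part i)
  part_nonneg : ∀ i y, 0 ≤ part i y
  part_tsupport : ∀ i, tsupport (part i) ⊆ (bdryChart i).source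
  part_sum : ∀ y, ∑ i, part i y = 1
  intCharts : Set (InteriorChart n B)
  intCharts_cover : ∀ b ∈ (𝓡∂ (n + 1)).interior B, ∃ e ∈ intCharts, b ∈ e.source
  θ : ℝ → ℝ
  θ_cutoff : IsCutoff θ
  J : Type
  fintype_J : Fintype J
  intChart : J → InteriorChart n B
  intChart_mem : ∀ j, intChart j ∈ intCharts
  ψ : J → B → ℝ
  ψ_smooth : ∀ j, ContMDiff (𝓡∂ (n + 1)) 𝓘(ℝ, ℝ) ∞ (ψ j)
  ψ_compact : ∀ j, HasCompactSupport (ψ j)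
  ψ_tsupport : ∀ j, tsupport (ψ j) ⊆ (intChart j).source
  ψ_sum : ∀ b ∈ (𝓡∂ (n + 1)).interior B, ∑ j, ψ j b = 1 - C.cutoff θ b

attribute [instance] LocalizationData.fintype_ι LocalizationData.fintype_J

variable {C : Collar n B Y}

/-- The collar chart `(x, y) ↦ (r, κᵢ y)`, `x = e^{-r}`, belonging to the chart `κᵢ` of `Y`. -/
def LocalizationData.collarChart (A : LocalizationData C) (i : A.ι) : InteriorChart n B :=
  C.logChart (A.bdryChart i) (A.bdryChart_mem i)

/-- The weight by which `u` has to be multiplied in the coordinates `(r, z)`, `x = e^{-r}`,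
`z = κᵢ y`, in order to obtain the local representation of `φᵢ S_γ(θ u)`, where
`(S_γ v)(r, y) = e^{(γ - (n+1)/2) r} v(e^{-r}, y)` and `φᵢ` is a function of the partition of unity
on `Y`. -/
def LocalizationData.collarWeight (A : LocalizationData C) (γ : ℝ) (θ : ℝ → ℝ) (i : A.ι)
    (w : E (n + 1)) : ℝ :=
  Real.exp ((γ - ((n : ℝ) + 1) / 2) * w 0) * θ (Real.exp (-w 0)) *
    A.part i ((A.bdryChart i).symm (tailE w))

/-- `u ∈ H^s_{p,loc}(Int B)`: for all charts `e` and all `χ ∈ C_c^∞(dom e)`, the local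
representation of `χ u` belongs to `H^s_p(ℝⁿ⁺¹)`. -/
def MemSobolevLoc (A : LocalizationData C) (s : ℝ) (p : ℝ≥0∞) [Fact (1 ≤ p)]
    (u : InteriorDistribution n B) : Prop :=
  ∀ e ∈ A.intCharts, ∀ χ : B → ℝ, ContMDiff (𝓡∂ (n + 1)) 𝓘(ℝ, ℝ) ∞ χ → HasCompactSupport χ →
    tsupport χ ⊆ e.source → MemSobolevInChart s p u e (fun z => χ (e.symm z))

/-- `S_γ(θ u) ∈ H^s_p(ℝ × Y)`: all the products `φᵢ S_γ(θ u)` with the functions of the partition of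
unity belong to `H^s_p(ℝⁿ⁺¹)` in the coordinates `(r, κᵢ y)`. -/
def MemSobolevCylinder (A : LocalizationData C) (s γ : ℝ) (p : ℝ≥0∞) [Fact (1 ≤ p)]
    (θ : ℝ → ℝ) (u : InteriorDistribution n B) : Prop :=
  ∀ i : A.ι, MemSobolevInChart s p u (A.collarChart i) (A.collarWeight γ θ i)

/-- The cone Sobolev space `𝓗^{s,γ}_p(B)`: all `u ∈ H^s_{p,loc}(Int B)` such that
`S_γ(θ u) ∈ H^s_p(ℝ × ∂B)` for every cut-off function `θ`. -/
def MemConeSobolev (A : LocalizationData C) (s γ : ℝ) (p : ℝ≥0∞) [Fact (1 ≤ p)]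
    (u : InteriorDistribution n B) : Prop :=
  MemSobolevLoc A s p u ∧ ∀ θ : ℝ → ℝ, IsCutoff θ → MemSobolevCylinder A s γ p θ u

/-- The norm of `𝓗^{s,γ}_p(B)`: the `H^s_p`-norm of `S_γ(θ u)` on `ℝ × ∂B` plus the `H^s_p`-norm of
`(1 - θ) u`, both computed by localization. -/
def coneSobolevNorm (A : LocalizationData C) (s γ : ℝ) (p : ℝ≥0∞) [Fact (1 ≤ p)]
    (u : InteriorDistribution n B) : ℝ :=
  ∑ i : A.ι, sobolevNormInChart s p u (A.collarChart i) (A.collarWeight γ A.θ i) +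
    ∑ j : A.J, sobolevNormInChart s p u (A.intChart j) (fun z => A.ψ j ((A.intChart j).symm z))

end Manifold

end ConeSobolev

end

open ConeSobolev

/-! The weight in `S_γ` is chosen so that the estimate is the ordinary Sobolev embedding on the
cylinder, read in the variable r = -log x. Each product of a partition function φᵢ with
e^{(γ-(n+1)/2) r} u(e^{-r}, y) lies in H^s_p of Euclidean space of dimension d = n+1, hence is
bounded by a constant times its norm, because s > d/p. Where the cut-off is 1 the exponential equals
x^{-(γ-(n+1)/2)}; summing over i removes φᵢ, and moving the power of x to the right gives the claim.
If γ > (n+1)/2 this power tends to 0.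

The embedding (`exists_continuous_of_besselPotential_eq`) rests on the subordination formula
(1+|ξ|²)^{-s/2} = Γ(s/2)⁻¹ ∫₀^∞ t^{s/2-1} e^{-t} e^{-t|ξ|²} dt. The multiplier e^{-t|ξ|²} is
convolution with a Gaussian probability density bounded by (π/t)^{d/2}, so it maps L^p to bounded
functions with norm at most (π/t)^{d/(2p)}. The resulting t-integral converges exactly when s > d/p.
Density of Schwartz functions in L^p, p < ∞, extends the bound and makes the limit continuous.

That u itself is a continuous function is local: multiplication by a bump function equal to 1 near a
point gives a continuous density there. Such densities agree on overlaps
(`InteriorDistribution.IsGivenOn.eq_of_mem`) and are glued by a partition of unity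
(`InteriorDistribution.isGivenBy_of_cover`). -/

noncomputable section

namespace ConeSobolev

/-! ### Sobolev embedding for Bessel potentials on Euclidean space -/

section BesselKernel

set_option linter.unusedSectionVars false

open FourierTransform

variable {V : Type*} [NormedAddCommGroup V] [InnerProductSpace ℝ V] [FiniteDimensional ℝ V]
  [MeasurableSpace V] [BorelSpace V]

/-- The Fourier transform of `ξ ↦ exp (-t ‖ξ‖²)`. -/
def heatKernel (t : ℝ) (y : V) : ℝ :=
  (Real.pi / t) ^ ((Module.finrank ℝ V : ℝ) / 2) * Real.exp (-(Real.pi ^ 2 / t) * ‖y‖ ^ 2)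

theorem heatKernel_nonneg {t : ℝ} (ht : 0 < t) (y : V) : 0 ≤ heatKernel t y := by
  have := Real.pi_pos
  unfold heatKernel; positivity

theorem heatKernel_le {t : ℝ} (ht : 0 < t) (y : V) :
    heatKernel t y ≤ (Real.pi / t) ^ ((Module.finrank ℝ V : ℝ) / 2) := by
  have := Real.pi_pos
  refine mul_le_of_le_one_right (by positivity) (Real.exp_le_one_iff.2 ?_)
  have : 0 ≤ Real.pi ^ 2 / t * ‖y‖ ^ 2 := by positivity
  linarith

theorem continuous_heatKernel (t : ℝ) : Continuous (heatKernel t : V → ℝ) := by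
  unfold heatKernel; fun_prop

theorem integral_heatKernel {t : ℝ} (ht : 0 < t) (x : V) : ∫ y, heatKernel t (x - y) = 1 := by
  have hpi := Real.pi_pos
  rw [integral_sub_left_eq_self (fun y : V => heatKernel t y)]
  simp only [heatKernel]
  rw [integral_const_mul, GaussianFourier.integral_rexp_neg_mul_sq_norm (by positivity),
    ← Real.mul_rpow (by positivity) (by positivity)]
  have : Real.pi / t * (Real.pi / (Real.pi ^ 2 / t)) = 1 := by field_simp
  rw [this, Real.one_rpow]

theorem integrable_heatKernel {t : ℝ} (ht : 0 < t) (x : V) :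
    Integrable (fun y => heatKernel t (x - y)) := by
  -- A non-integrable function has integral 0 by convention, whereas this integral is 1.
  by_contra h
  have := integral_heatKernel ht x
  rw [integral_undef h] at this
  exact zero_ne_one this

/-- Since the kernel is a probability density, L¹ norms with respect to it are at most L^p norms
(Jensen). Bounding the density by its maximum then returns to Lebesgue measure at the cost of the
maximum to the power 1/p. -/
theorem lintegral_heatKernel_mul_enorm_le {t : ℝ} (ht : 0 < t) (x : V) {p : ℝ≥0∞} (hp : 1 ≤ p)
    (hp' : p ≠ ⊤) {f : V → ℂ} (hf : AEStronglyMeasurable f) :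
    ∫⁻ y, ENNReal.ofReal (heatKernel t (x - y)) * ‖f y‖ₑ ≤
      ENNReal.ofReal ((Real.pi / t) ^ ((Module.finrank ℝ V : ℝ) / 2)) ^ (1 / p).toReal *
        eLpNorm f p volume := by
  set k : V → ℝ≥0∞ := fun y => ENNReal.ofReal (heatKernel t (x - y)) with hk
  have hkm : Measurable k := by
    have : Continuous fun y : V => heatKernel t (x - y) :=
      (continuous_heatKernel t).comp (by fun_prop)
    exact this.measurable.ennreal_ofReal
  set μ : Measure V := volume.withDensity k with hμ
  have hprob : IsProbabilityMeasure μ := by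
    constructor
    rw [hμ, withDensity_apply _ MeasurableSet.univ, setLIntegral_univ, hk,
      ← ofReal_integral_eq_lintegral_ofReal (integrable_heatKernel ht x)
        (ae_of_all _ fun y => heatKernel_nonneg ht _), integral_heatKernel ht, ENNReal.ofReal_one]
  have hle : μ ≤ ENNReal.ofReal ((Real.pi / t) ^ ((Module.finrank ℝ V : ℝ) / 2)) •
      (volume : Measure V) := by
    rw [← withDensity_const]
    exact withDensity_mono (ae_of_all _ fun y => ENNReal.ofReal_le_ofReal (heatKernel_le ht _))
  have hac : μ ≪ volume := withDensity_absolutelyContinuous _ _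
  calc ∫⁻ y, k y * ‖f y‖ₑ = eLpNorm f 1 μ := by
        rw [eLpNorm_one_eq_lintegral_enorm, hμ,
          lintegral_withDensity_eq_lintegral_mul₀ hkm.aemeasurable hf.enorm]
        rfl
    _ ≤ eLpNorm f p μ := eLpNorm_le_eLpNorm_of_exponent_le hp (hf.mono_ac hac)
    _ ≤ _ := eLpNorm_mono_measure f hle
    _ = _ := eLpNorm_smul_measure_of_ne_top hp' f _

/-- The Fourier transform can be moved from one factor of an integral to the other; here it is moved
onto the modulated Gaussian, whose transform is the heat kernel translated to x. -/
theorem integral_exp_mul_fourier (f : 𝓢(V, ℂ)) {t : ℝ} (ht : 0 < t) (x : V) :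
    ∫ ξ : V, Complex.exp (-(t : ℂ) * ‖ξ‖ ^ 2 + 2 * Real.pi * Complex.I * (inner ℝ x ξ : ℝ)) * 𝓕 f ξ =
      ∫ y, (heatKernel t (x - y) : ℂ) * f y := by
  have hre : 0 < (t : ℂ).re := by simpa
  have hint : Integrable fun ξ : V =>
      Complex.exp (-(t : ℂ) * ‖ξ‖ ^ 2 + 2 * Real.pi * Complex.I * (inner ℝ x ξ : ℝ)) :=
    GaussianFourier.integrable_cexp_neg_mul_sq_norm_add hre _ x
  have h := VectorFourier.integral_fourierIntegral_smul_eq_flip (e := Real.fourierChar)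
    (μ := (volume : Measure V)) (ν := (volume : Measure V)) (L := innerₗ V)
    Real.continuous_fourierChar continuous_inner hint f.integrable
  have hfl : (innerₗ V).flip = innerₗ V := by
    ext a b; simp
  rw [hfl] at h
  simp only [smul_eq_mul] at h
  have e1 : ∀ y : V, VectorFourier.fourierIntegral Real.fourierChar volume (innerₗ V)
      (fun ξ : V => Complex.exp (-(t : ℂ) * ‖ξ‖ ^ 2 +
        2 * Real.pi * Complex.I * (inner ℝ x ξ : ℝ))) y = (heatKernel t (x - y) : ℂ) := by
    intro y
    refine (fourier_gaussian_innerProductSpace' hre x y).trans ?_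
    have : ((Real.pi / t : ℝ) : ℂ) ^ (((Module.finrank ℝ V : ℝ) / 2 : ℝ) : ℂ) =
        (((Real.pi / t) ^ ((Module.finrank ℝ V : ℝ) / 2) : ℝ) : ℂ) :=
      (Complex.ofReal_cpow (by have := Real.pi_pos; positivity) _).symm
    rw [heatKernel, Complex.ofReal_mul, ← this]
    push_cast
    congr 2
    ring
  simp only [e1] at h
  exact h.symm

theorem norm_integral_exp_mul_fourier_le (f : 𝓢(V, ℂ)) {t : ℝ} (ht : 0 < t) (x : V) {p : ℝ≥0∞}
    [Fact (1 ≤ p)] (hp' : p ≠ ⊤) :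
    ‖∫ ξ : V, Complex.exp (-(t : ℂ) * ‖ξ‖ ^ 2 + 2 * Real.pi * Complex.I * (inner ℝ x ξ : ℝ)) *
      𝓕 f ξ‖ ≤ ((Real.pi / t) ^ ((Module.finrank ℝ V : ℝ) / 2)) ^ (1 / p).toReal *
        ‖f.toLp p volume‖ := by
  rw [integral_exp_mul_fourier f ht]
  have hpi := Real.pi_pos
  have h := lintegral_heatKernel_mul_enorm_le ht x (Fact.out : 1 ≤ p) hp'
    f.continuous.aestronglyMeasurable
  have h2 : ‖∫ y, (heatKernel t (x - y) : ℂ) * f y‖ₑ ≤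
      ENNReal.ofReal ((Real.pi / t) ^ ((Module.finrank ℝ V : ℝ) / 2)) ^ (1 / p).toReal *
        eLpNorm f p volume := by
    refine (enorm_integral_le_lintegral_enorm _).trans (le_of_eq_of_le ?_ h)
    congr 1
    ext y
    rw [enorm_mul, ← ofReal_norm, Complex.norm_real, Real.norm_of_nonneg (heatKernel_nonneg ht _)]
  have h3 : eLpNorm f p (volume : Measure V) ≠ ⊤ := (f.eLpNorm_lt_top p volume).ne
  rw [SchwartzMap.norm_toLp, ← toReal_enorm]
  set c : ℝ := (Real.pi / t) ^ ((Module.finrank ℝ V : ℝ) / 2) with hc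
  have hc0 : 0 ≤ c := by positivity
  have h4 : ENNReal.ofReal c ^ (1 / p).toReal ≠ ⊤ :=
    ENNReal.rpow_ne_top_of_nonneg ENNReal.toReal_nonneg ENNReal.ofReal_ne_top
  refine (ENNReal.toReal_mono (ENNReal.mul_ne_top h4 h3) h2).trans_eq ?_
  rw [ENNReal.toReal_mul, ← ENNReal.toReal_rpow, ENNReal.toReal_ofReal hc0]

variable (V) in
/-- The bound for the norm of the embedding of the Bessel potential space into the bounded
functions. -/
def besselConst (s : ℝ) (p : ℝ≥0∞) : ℝ :=
  (Real.Gamma (s / 2))⁻¹ * ∫ t in Ioi (0 : ℝ), Real.exp (-t) * t ^ (s / 2 - 1) *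
    ((Real.pi / t) ^ ((Module.finrank ℝ V : ℝ) / 2)) ^ (1 / p).toReal

theorem besselConst_nonneg {s : ℝ} (hs : 0 < s) (p : ℝ≥0∞) : 0 ≤ besselConst V s p := by
  have := Real.pi_pos
  refine mul_nonneg (inv_nonneg.2 (Real.Gamma_pos_of_pos (by positivity)).le)
    (setIntegral_nonneg measurableSet_Ioi fun t (ht : 0 < t) => by positivity)

/-- With a = d/(2p) the integrand is π^a e^{-t} t^{s/2-a-1}, a Gamma integrand of positive parameter
s/2 - a. This is where s > d/p enters. -/
theorem integrableOn_besselConst {s : ℝ} {p : ℝ≥0∞} (hs : Module.finrank ℝ V / p.toReal < s) :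
    IntegrableOn (fun t => Real.exp (-t) * t ^ (s / 2 - 1) *
      ((Real.pi / t) ^ ((Module.finrank ℝ V : ℝ) / 2)) ^ (1 / p).toReal) (Ioi 0) := by
  set a : ℝ := (Module.finrank ℝ V : ℝ) / 2 * (1 / p).toReal with ha
  have hpos : 0 < s / 2 - a := by
    have : a = Module.finrank ℝ V / p.toReal / 2 := by
      rw [ha, one_div, ENNReal.toReal_inv]; ring
    linarith
  have h : IntegrableOn (fun t => Real.exp (-t) * t ^ (s / 2 - a - 1) * Real.pi ^ a) (Ioi 0) :=
    (Real.GammaIntegral_convergent hpos).mul_const (Real.pi ^ a)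
  refine h.congr_fun (fun t (ht : 0 < t) => ?_) measurableSet_Ioi
  have hpi := Real.pi_pos
  simp only
  rw [← Real.rpow_mul (by positivity), ← ha, Real.div_rpow hpi.le ht.le,
    show s / 2 - a - 1 = (s / 2 - 1) - a by ring, Real.rpow_sub ht]
  ring

/-- The bound follows from writing the multiplier as a superposition of Gaussians, exchanging the
integrals, and estimating each Gaussian multiplier by `norm_integral_exp_mul_fourier_le`. -/
theorem norm_besselPotential_schwartz_le {s : ℝ} {p : ℝ≥0∞} [Fact (1 ≤ p)] (hp' : p ≠ ⊤)
    (hs : Module.finrank ℝ V / p.toReal < s) (f : 𝓢(V, ℂ)) (x : V) :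
    ‖SchwartzMap.fourierMultiplierCLM ℂ (fun x : V => (((1 + ‖x‖ ^ 2) ^ (-s / 2) : ℝ) : ℂ)) f x‖ ≤
      besselConst V s p * ‖f.toLp p volume‖ := by
  have hs0 : 0 < s / 2 := by
    have : 0 ≤ Module.finrank ℝ V / p.toReal := by positivity
    linarith
  have hG : 0 < Real.Gamma (s / 2) := Real.Gamma_pos_of_pos hs0
  -- Integrated first in t, `F` reproduces the Bessel multiplier up to Γ(s/2); integrated first in
  -- v, it gives the Gaussian multipliers.
  set F : V → ℝ → ℂ := fun v t => ((Real.exp (-t) * t ^ (s / 2 - 1) : ℝ) : ℂ) *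
    (Complex.exp (-(t : ℂ) * ‖v‖ ^ 2 + 2 * Real.pi * Complex.I * (inner ℝ x v : ℝ)) * 𝓕 f v) with hF
  have hmult : SchwartzMap.fourierMultiplierCLM ℂ
      (fun x : V => (((1 + ‖x‖ ^ 2) ^ (-s / 2) : ℝ) : ℂ)) f x =
      (Real.Gamma (s / 2) : ℂ)⁻¹ * ∫ v : V, ∫ t in Ioi (0 : ℝ), F v t := by
    rw [SchwartzMap.fourierMultiplierCLM_apply, SchwartzMap.fourierInv_coe, Real.fourierInv_eq',
      ← integral_const_mul]
    congr 1
    ext v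
    rw [SchwartzMap.smulLeftCLM_apply_apply (by fun_prop)]
    have h1 : ∀ t ∈ Ioi (0 : ℝ), F v t = ((t ^ (s / 2 - 1) *
        Real.exp (-((1 + ‖v‖ ^ 2) * t)) : ℝ) : ℂ) *
        (Complex.exp (2 * Real.pi * Complex.I * (inner ℝ x v : ℝ)) * 𝓕 f v) := by
      intro t ht
      simp only [hF]
      rw [show -((1 + ‖v‖ ^ 2) * t) = -t + (-t * ‖v‖ ^ 2) by ring, Real.exp_add, Complex.exp_add]
      push_cast
      ring
    rw [setIntegral_congr_fun measurableSet_Ioi h1, integral_mul_const, integral_complex_ofReal,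
      Real.integral_rpow_mul_exp_neg_mul_Ioi hs0 (by positivity), one_div,
      Real.inv_rpow (by positivity), ← Real.rpow_neg (by positivity), neg_div]
    have hG' : (Real.Gamma (s / 2) : ℂ) ≠ 0 := by exact_mod_cast hG.ne'
    rw [real_inner_comm]
    push_cast
    simp only [smul_eq_mul]
    field_simp
  have hmeas : AEStronglyMeasurable (Function.uncurry F)
      ((volume : Measure V).prod (volume.restrict (Ioi (0 : ℝ)))) := by
    have h1 : Measurable fun q : V × ℝ => 𝓕 f q.1 :=
      (𝓕 f).continuous.measurable.comp measurable_fst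
    refine Measurable.aestronglyMeasurable ?_
    simp only [hF, Function.uncurry_def]
    fun_prop
  have hint : Integrable (Function.uncurry F)
      ((volume : Measure V).prod (volume.restrict (Ioi (0 : ℝ)))) := by
    -- Gaussian and character have modulus at most 1, so a product of integrable functions of v and
    -- of t dominates `F`.
    have h0 := Integrable.mul_prod ((𝓕 f).integrable (μ := (volume : Measure V))).norm
      (Real.GammaIntegral_convergent hs0)
    refine h0.mono' hmeas ?_
    have hprod : (volume : Measure V).prod (volume.restrict (Ioi (0 : ℝ))) =
        ((volume : Measure V).prod volume).restrict (univ ×ˢ Ioi 0) := by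
      rw [← Measure.prod_restrict, Measure.restrict_univ]
    rw [hprod]
    refine ae_restrict_of_forall_mem (MeasurableSet.univ.prod measurableSet_Ioi) ?_
    rintro ⟨v, t⟩ ⟨-, ht : 0 < t⟩
    simp only [Function.uncurry_apply_pair, hF, norm_mul, Complex.norm_real, Complex.norm_exp]
    rw [Real.norm_of_nonneg (by positivity : (0 : ℝ) ≤ Real.exp (-t)),
      Real.norm_of_nonneg (by positivity : (0 : ℝ) ≤ t ^ (s / 2 - 1))]
    have : Real.exp (-(t : ℂ) * ‖v‖ ^ 2 + 2 * Real.pi * Complex.I * (inner ℝ x v : ℝ)).re ≤ 1 := by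
      rw [Real.exp_le_one_iff]
      have e : (-(t : ℂ) * ‖v‖ ^ 2 + 2 * Real.pi * Complex.I * (inner ℝ x v : ℝ)) =
        ((-t * ‖v‖ ^ 2 : ℝ) : ℂ) + ((2 * Real.pi * inner ℝ x v : ℝ) : ℂ) * Complex.I := by
        push_cast; ring
      rw [e]
      simp only [Complex.add_re, Complex.ofReal_re, Complex.re_ofReal_mul, Complex.I_re, mul_zero,
        add_zero]
      nlinarith [sq_nonneg ‖v‖]
    calc _ ≤ Real.exp (-t) * t ^ (s / 2 - 1) * (1 * ‖𝓕 f v‖) := by gcongr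
      _ = _ := by ring
  rw [hmult, integral_integral_swap hint, norm_mul, norm_inv, Complex.norm_real,
    Real.norm_of_nonneg hG.le, besselConst, mul_assoc]
  gcongr
  rw [← integral_mul_const]
  refine norm_integral_le_of_norm_le ((integrableOn_besselConst hs).mul_const _) ?_
  refine ae_restrict_of_forall_mem measurableSet_Ioi fun t (ht : 0 < t) => ?_
  simp only [hF]
  rw [integral_const_mul, norm_mul, Complex.norm_real, mul_assoc (Real.exp (-t)),
    Real.norm_of_nonneg (by positivity)]
  rw [mul_assoc (Real.exp (-t)), mul_assoc (Real.exp (-t)), mul_assoc (t ^ (s / 2 - 1))]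
  gcongr
  exact norm_integral_exp_mul_fourier_le f ht x hp'

/-- The Sobolev embedding theorem for Bessel potential spaces. -/
theorem exists_continuous_of_besselPotential_eq {s : ℝ} {p : ℝ≥0∞} [Fact (1 ≤ p)] (hp' : p ≠ ⊤)
    (hs : Module.finrank ℝ V / p.toReal < s) {T : 𝓢'(V, ℂ)} {f : Lp ℂ p (volume : Measure V)}
    (hT : TemperedDistribution.besselPotential V ℂ s T = f) :
    ∃ g : V → ℂ, Continuous g ∧ (∀ x, ‖g x‖ ≤ besselConst V s p * ‖f‖) ∧
      ∀ φ : 𝓢(V, ℂ), T φ = ∫ x, φ x * g x := by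
  have hpos : 0 < s := lt_of_le_of_lt (by positivity) hs
  have hC := besselConst_nonneg (V := V) hpos p
  have hT' : TemperedDistribution.besselPotential V ℂ (-s) f = T :=
    (TemperedDistribution.besselPotential_neg_apply_eq_iff s _ _).2 hT
  set m : V → ℂ := fun x => (((1 + ‖x‖ ^ 2) ^ (-s / 2) : ℝ) : ℂ) with hm
  have hmt : m.HasTemperateGrowth := by simp only [hm]; fun_prop
  obtain ⟨φ, hφ⟩ : ∃ φ : ℕ → 𝓢(V, ℂ),
      Tendsto (fun k => (φ k).toLp p (volume : Measure V)) atTop (𝓝 f) := by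
    have hd := SchwartzMap.denseRange_toLpCLM (E := V) (F := ℂ) (p := p) hp' (μ := volume)
    obtain ⟨x, hx, hx'⟩ := mem_closure_iff_seq_limit.1 (hd.closure_range ▸ mem_univ f)
    choose φ hφ using hx
    refine ⟨φ, ?_⟩
    convert hx' using 2 with k
    exact hφ k
  set J : 𝓢(V, ℂ) →L[ℂ] 𝓢(V, ℂ) := SchwartzMap.fourierMultiplierCLM ℂ m with hJ
  set G : ℕ → BoundedContinuousFunction V ℂ := fun k => (J (φ k)).toBoundedContinuousFunction
  -- By linearity the sup bound applies to differences, so L^p convergence of the approximations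
  -- forces uniform convergence of their potentials.
  have hdist : ∀ k l, dist (G k) (G l) ≤ besselConst V s p *
      dist ((φ k).toLp p (volume : Measure V)) ((φ l).toLp p volume) := by
    intro k l
    rw [BoundedContinuousFunction.dist_le (by positivity)]
    intro x
    have h := norm_besselPotential_schwartz_le hp' hs (φ k - φ l) x
    have e : (φ k - φ l).toLp p (volume : Measure V) = (φ k).toLp p volume - (φ l).toLp p volume :=
      map_sub (SchwartzMap.toLpCLM ℂ ℂ p (volume : Measure V)) _ _
    rw [e, ← dist_eq_norm, map_sub] at h
    rw [dist_eq_norm]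
    exact h
  have hcau : CauchySeq G := by
    have h0 := hφ.cauchySeq
    rw [Metric.cauchySeq_iff'] at h0 ⊢
    intro ε hε
    -- The summand 1 avoids dividing by a constant known only to be nonnegative.
    obtain ⟨N, hN⟩ := h0 (ε / (besselConst V s p + 1)) (by positivity)
    refine ⟨N, fun k hk => (hdist k N).trans_lt ?_⟩
    have := hN k hk
    rw [lt_div_iff₀ (by positivity)] at this
    nlinarith [dist_nonneg (x := (φ k).toLp p (volume : Measure V)) (y := (φ N).toLp p volume)]
  obtain ⟨g, hg⟩ := cauchySeq_tendsto_of_complete hcau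
  have hgx : ∀ x, Tendsto (fun k => J (φ k) x) atTop (𝓝 (g x)) := fun x =>
    ((BoundedContinuousFunction.evalCLM ℂ x).continuous.tendsto g).comp hg
  refine ⟨g, g.continuous, fun x => ?_, fun ψ => ?_⟩
  · exact le_of_tendsto_of_tendsto' (hgx x).norm (hφ.norm.const_mul _)
      fun k => norm_besselPotential_schwartz_le hp' hs (φ k) x
  -- Both sides of the pairing pass to the limit: the left by continuity of L^p → 𝓢' and of the
  -- Bessel potential, the right by dominated convergence with a uniform bound `R` on the
  -- potentials.
  · have h1 : Tendsto (fun k => (TemperedDistribution.besselPotential V ℂ (-s)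
        ((φ k).toLp p (volume : Measure V) : Lp ℂ p (volume : Measure V))) ψ) atTop (𝓝 (T ψ)) := by
      rw [← hT']
      have hc : Continuous fun F : Lp ℂ p (volume : Measure V) =>
          (TemperedDistribution.besselPotential V ℂ (-s) (F : 𝓢'(V, ℂ))) ψ := by
        have h2 := (Lp.toTemperedDistributionCLM ℂ (volume : Measure V) p).continuous
        have h3 := (TemperedDistribution.besselPotential V ℂ (-s)).continuous
        have h4 : Continuous fun D : 𝓢'(V, ℂ) => D ψ :=
          (PointwiseConvergenceCLM.evalCLM (RingHom.id ℂ) ℂ ψ).continuous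
        exact h4.comp (h3.comp h2)
      exact (hc.tendsto f).comp hφ
    have h2 : ∀ k, (TemperedDistribution.besselPotential V ℂ (-s)
        ((φ k).toLp p (volume : Measure V) : Lp ℂ p (volume : Measure V))) ψ =
        ∫ x, ψ x * J (φ k) x := by
      intro k
      rw [Lp.toTemperedDistribution_toLp_eq, TemperedDistribution.besselPotential,
        TemperedDistribution.fourierMultiplierCLM_toTemperedDistributionCLM_eq hmt,
        SchwartzMap.toTemperedDistributionCLM_apply_apply volume]
      rfl
    simp only [h2] at h1
    refine tendsto_nhds_unique h1 ?_
    obtain ⟨R, hR⟩ : ∃ R, ∀ k, ‖G k‖ ≤ R := by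
      obtain ⟨R, hR⟩ := hcau.isBounded_range.exists_norm_le
      exact ⟨R, fun k => hR _ ⟨k, rfl⟩⟩
    refine tendsto_integral_of_dominated_convergence (fun x => ‖ψ x‖ * R)
      (fun k => (ψ.continuous.mul (J (φ k)).continuous).aestronglyMeasurable)
      (ψ.integrable.norm.mul_const R) (fun k => ae_of_all _ fun x => ?_)
      (ae_of_all _ fun x => (hgx x).const_mul _)
    rw [norm_mul]
    gcongr
    exact ((G k).norm_coe_le_norm x).trans (hR k)

end BesselKernel

/-! ### Test functions and continuous densities -/

section TestFunctions

set_option linter.unusedSectionVars false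

variable {F : Type*} [NormedAddCommGroup F] [InnerProductSpace ℝ F] [FiniteDimensional ℝ F]
  [MeasurableSpace F] [BorelSpace F]

theorem tsupport_indicator_subset {U K : Set F} (hK : IsClosed K) {φ : F → ℝ}
    (h0 : ∀ z ∈ U, z ∉ K → φ z = 0) : tsupport (U.indicator φ) ⊆ K := by
  refine closure_minimal (fun z hz => ?_) hK
  by_contra hzK
  refine hz ?_
  by_cases hU : z ∈ U
  · rw [indicator_of_mem hU, h0 z hU hzK]
  · exact indicator_of_notMem hU _

/-- A smooth function on an open set `U` that vanishes off a closed subset of `U` is smooth after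
extension by zero. -/
theorem contDiff_indicator {U K : Set F} (hU : IsOpen U) (hK : IsClosed K) (hKU : K ⊆ U)
    {φ : F → ℝ} (hφ : ContDiffOn ℝ ∞ φ U) (h0 : ∀ z ∈ U, z ∉ K → φ z = 0) :
    ContDiff ℝ ∞ (U.indicator φ) := by
  rw [contDiff_iff_contDiffAt]
  intro z
  by_cases hz : z ∈ U
  · refine (hφ.contDiffAt (hU.mem_nhds hz)).congr_of_eventuallyEq ?_
    filter_upwards [hU.mem_nhds hz] with w hw using indicator_of_mem hw _
  · have hzK : z ∉ tsupport (U.indicator φ) :=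
      fun h => hz (hKU (tsupport_indicator_subset hK h0 h))
    refine (contDiffAt_const (c := (0 : ℝ))).congr_of_eventuallyEq ?_
    exact notMem_tsupport_iff_eventuallyEq.1 hzK

/-- Extension by zero, as a test function, of a smooth function on the open set `U` that vanishes
off the compact subset `K` of `U`. -/
def testFunctionOfIndicator {Ω : TopologicalSpace.Opens F} {U K : Set F} (hU : IsOpen U)
    (hK : IsCompact K) (hKU : K ⊆ U) (hKΩ : K ⊆ Ω) (φ : F → ℝ) (hφ : ContDiffOn ℝ ∞ φ U)
    (h0 : ∀ z ∈ U, z ∉ K → φ z = 0) : 𝓓(Ω, ℝ) where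
  toFun := U.indicator φ
  contDiff' := contDiff_indicator hU hK.isClosed hKU hφ h0
  hasCompactSupport' := hK.of_isClosed_subset (isClosed_tsupport _)
    (tsupport_indicator_subset hK.isClosed h0)
  tsupport_subset' := (tsupport_indicator_subset hK.isClosed h0).trans hKΩ

theorem testFunctionOfIndicator_apply {Ω : TopologicalSpace.Opens F} {U K : Set F} (hU : IsOpen U)
    (hK : IsCompact K) (hKU : K ⊆ U) (hKΩ : K ⊆ Ω) (φ : F → ℝ) (hφ : ContDiffOn ℝ ∞ φ U)
    (h0 : ∀ z ∈ U, z ∉ K → φ z = 0) {z : F} (hz : z ∈ U) :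
    testFunctionOfIndicator hU hK hKU hKΩ φ hφ h0 z = φ z :=
  indicator_of_mem hz φ

theorem tsupport_testFunctionOfIndicator {Ω : TopologicalSpace.Opens F} {U K : Set F}
    (hU : IsOpen U) (hK : IsCompact K) (hKU : K ⊆ U) (hKΩ : K ⊆ Ω) (φ : F → ℝ)
    (hφ : ContDiffOn ℝ ∞ φ U) (h0 : ∀ z ∈ U, z ∉ K → φ z = 0) :
    tsupport (testFunctionOfIndicator hU hK hKU hKΩ φ hφ h0) ⊆ K :=
  tsupport_indicator_subset hK.isClosed h0

theorem integrableOn_testFunction_mul {Ω : TopologicalSpace.Opens F} (η : 𝓓(Ω, ℝ)) {f : F → ℂ}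
    (hf : ∀ K : Set F, IsCompact K → K ⊆ tsupport η → ContinuousOn f K) :
    IntegrableOn (fun z => (η z : ℂ) * f z) Ω := by
  have hK : IsCompact (tsupport η) := η.hasCompactSupport
  have h1 : IntegrableOn (fun z => (η z : ℂ) * f z) (tsupport η) :=
    ((Complex.continuous_ofReal.comp η.continuous).continuousOn.mul
      (hf _ hK le_rfl)).integrableOn_compact hK
  refine ((integrableOn_iff_integrable_of_support_subset fun z hz => ?_).1 h1).integrableOn
  refine subset_tsupport _ fun h0 => hz ?_
  simp [h0]

/-- Continuous functions on an open set are determined by their integrals against smooth compactly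
supported functions. -/
theorem eqOn_of_integral_contDiff_mul_eq {W : Set F} (hW : IsOpen W) {f g : F → ℂ}
    (hf : ContinuousOn f W) (hg : ContinuousOn g W)
    (h : ∀ φ : F → ℝ, ContDiff ℝ ∞ φ → HasCompactSupport φ → tsupport φ ⊆ W →
      ∫ z in W, (φ z : ℂ) * f z = ∫ z in W, (φ z : ℂ) * g z) : EqOn f g W := by
  have hae : ∀ᵐ z, z ∈ W → (f - g) z = 0 := by
    refine hW.ae_eq_zero_of_integral_contDiff_smul_eq_zero
      ((hf.sub hg).locallyIntegrableOn hW.measurableSet) fun φ h1 h2 h3 => ?_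
    let η : 𝓓((⟨W, hW⟩ : TopologicalSpace.Opens F), ℝ) := ⟨φ, h1, h2, h3⟩
    have hif : IntegrableOn (fun z => (φ z : ℂ) * f z) W :=
      integrableOn_testFunction_mul η fun K _ hKs => hf.mono (hKs.trans h3)
    have hig : IntegrableOn (fun z => (φ z : ℂ) * g z) W :=
      integrableOn_testFunction_mul η fun K _ hKs => hg.mono (hKs.trans h3)
    have e : ∫ z, φ z • (f - g) z = ∫ z in W, ((φ z : ℂ) * f z - (φ z : ℂ) * g z) := by
      rw [← setIntegral_eq_integral_of_forall_compl_eq_zero (s := W)]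
      · refine setIntegral_congr_fun hW.measurableSet fun z _ => ?_
        simp [mul_sub]
      · intro z hz
        rw [image_eq_zero_of_notMem_tsupport fun hz' => hz (h3 hz'), zero_smul]
    rw [e, integral_sub hif hig, h φ h1 h2 h3, sub_self]
  refine Measure.eqOn_open_of_ae_eq (μ := volume) ?_ hW hf hg
  refine (ae_restrict_iff' hW.measurableSet).2 ?_
  filter_upwards [hae] with z hz hzW using sub_eq_zero.1 (hz hzW)

/-- By the Leibniz formula the determinant is a polynomial in the matrix entries. This makes
Jacobians of transition maps smooth. -/
theorem contDiff_det (d : ℕ) : ContDiff ℝ ∞ fun A : E d →L[ℝ] E d => A.det := by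
  let b := (EuclideanSpace.basisFun (Fin d) ℝ).toBasis
  have h : (fun A : E d →L[ℝ] E d => A.det) =
      fun A => ∑ σ : Equiv.Perm (Fin d), ((Equiv.Perm.sign σ : ℤ) : ℝ) * ∏ i, A (b i) (σ i) := by
    ext A
    rw [ContinuousLinearMap.det, ← LinearMap.det_toMatrix b, Matrix.det_apply']
    simp [LinearMap.toMatrix_apply, b]
  rw [h]
  refine ContDiff.sum fun σ _ => contDiff_const.mul (contDiff_prod fun i _ => ?_)
  have h1 : ContDiff ℝ ∞ fun A : E d →L[ℝ] E d => A (b i) := contDiff_id.clm_apply contDiff_const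
  exact (contDiff_euclidean.1 h1) (σ i)

end TestFunctions

/-! ### Change of charts, uniqueness and gluing of densities -/

section Charts

variable {n : ℕ} {B : Type*} [TopologicalSpace B] [ChartedSpace (EuclideanHalfSpace (n + 1)) B]

theorem InteriorChart.contDiffOn_transition (e e' : InteriorChart n B) :
    ContDiffOn ℝ ∞ (e.transition e') (e.transition e').source := by
  rw [← contMDiffOn_iff_contDiffOn]
  exact e'.smooth.comp (e.smooth_symm.mono fun z hz => hz.1) fun z hz => hz.2

theorem InteriorChart.transition_symm (e e' : InteriorChart n B) :
    (e.transition e').symm = e'.transition e := by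
  rw [transition, OpenPartialHomeomorph.trans_symm_eq_symm_trans_symm,
    OpenPartialHomeomorph.symm_symm, transition]

/-- The chain rule for τ⁻¹ ∘ τ = id makes the derivative invertible. Nonvanishing is what keeps |det
Dτ| smooth, so that a test function pulled back as a density is again a test function. -/
theorem InteriorChart.det_fderiv_transition_ne_zero (e e' : InteriorChart n B) {z : E (n + 1)}
    (hz : z ∈ (e.transition e').source) : (fderiv ℝ (e.transition e') z).det ≠ 0 := by
  set τ := e.transition e' with hτ
  have h1 : HasFDerivAt τ (fderiv ℝ τ z) z :=
    (((e.contDiffOn_transition e').contDiffAt (τ.open_source.mem_nhds hz)).differentiableAt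
      (by simp)).hasFDerivAt
  have h2 : HasFDerivAt τ.symm (fderiv ℝ τ.symm (τ z)) (τ z) := by
    have h3 : τ z ∈ τ.symm.source := τ.map_source hz
    have h4 := e'.contDiffOn_transition e
    rw [← e.transition_symm e'] at h4
    exact ((h4.contDiffAt (τ.symm.open_source.mem_nhds h3)).differentiableAt
      (by simp)).hasFDerivAt
  have h5 : HasFDerivAt id ((fderiv ℝ τ.symm (τ z)).comp (fderiv ℝ τ z)) z := by
    refine (h2.comp z h1).congr_of_eventuallyEq ?_
    filter_upwards [τ.open_source.mem_nhds hz] with w hw using (τ.left_inv hw).symm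
  have h6 := h5.unique (hasFDerivAt_id z)
  intro h0
  have h7 := LinearMap.det_comp (fderiv ℝ τ.symm (τ z) : E (n + 1) →ₗ[ℝ] E (n + 1)) (fderiv ℝ τ z)
  have h8 : LinearMap.det (fderiv ℝ τ z : E (n + 1) →ₗ[ℝ] E (n + 1)) = 0 := h0
  rw [← ContinuousLinearMap.toLinearMap_comp, h6, h8, mul_zero] at h7
  simp at h7

theorem InteriorChart.mem_transition_source (e e' : InteriorChart n B) {z : E (n + 1)} :
    z ∈ (e.transition e').source ↔ z ∈ e.target ∧ e.symm z ∈ e'.source := by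
  simp [transition]

theorem InteriorChart.mem_transition_target (e e' : InteriorChart n B) {z : E (n + 1)} :
    z ∈ (e.transition e').target ↔ z ∈ e'.target ∧ e'.symm z ∈ e.source := by
  rw [← OpenPartialHomeomorph.symm_source, transition_symm, mem_transition_source]

theorem InteriorChart.symm_transition (e e' : InteriorChart n B) {z : E (n + 1)}
    (hz : z ∈ (e.transition e').source) : e'.symm (e.transition e' z) = e.symm z := by
  rw [mem_transition_source] at hz
  exact e'.left_inv hz.2

/-- The pull-back, as a density, of a test function under a change of charts. -/
theorem InteriorChart.exists_testFunction_transition (e e' : InteriorChart n B)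
    (η' : 𝓓(e'.range, ℝ)) (hη' : tsupport η' ⊆ (e.transition e').target) :
    ∃ η : 𝓓(e.range, ℝ), tsupport η ⊆ (e.transition e').symm '' tsupport η' ∧
      ∀ z ∈ (e.transition e').source,
        η z = |(fderiv ℝ (e.transition e') z).det| * η' (e.transition e' z) := by
  set τ := e.transition e' with hτ
  have hK : IsCompact (τ.symm '' tsupport η') :=
    IsCompact.image_of_continuousOn η'.hasCompactSupport (τ.continuousOn_symm.mono hη')
  have hKU : τ.symm '' tsupport η' ⊆ τ.source := by
    rintro _ ⟨w, hw, rfl⟩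
    exact τ.map_target (hη' hw)
  have hKΩ : τ.symm '' tsupport η' ⊆ e.range :=
    hKU.trans fun z hz => ((e.mem_transition_source e').1 hz).1
  have hτs : ContDiffOn ℝ ∞ τ τ.source := e.contDiffOn_transition e'
  have hφ : ContDiffOn ℝ ∞ (fun z => |(fderiv ℝ τ z).det| * η' (τ z)) τ.source := by
    refine ContDiffOn.mul ?_ (η'.contDiff.comp_contDiffOn hτs)
    have h1 := (contDiff_det (n + 1)).comp_contDiffOn
      (hτs.fderiv_of_isOpen τ.open_source (m := ∞) (by simp))
    intro z hz
    exact ((h1.contDiffAt (τ.open_source.mem_nhds hz)).abs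
      (e.det_fderiv_transition_ne_zero e' hz)).contDiffWithinAt
  have h0 : ∀ z ∈ τ.source, z ∉ τ.symm '' tsupport η' →
      |(fderiv ℝ τ z).det| * η' (τ z) = 0 := by
    intro z hz hzK
    rw [image_eq_zero_of_notMem_tsupport (f := η') fun h => hzK ⟨_, h, τ.left_inv hz⟩, mul_zero]
  exact ⟨testFunctionOfIndicator τ.open_source hK hKU hKΩ _ hφ h0,
    tsupport_testFunctionOfIndicator _ _ _ _ _ _ _,
    fun z hz => testFunctionOfIndicator_apply _ _ _ _ _ _ _ hz⟩

/-- The distribution `u` is given by the function `f` on the subset `U` of `Int B`. -/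
def InteriorDistribution.IsGivenOn (u : InteriorDistribution n B) (f : B → ℂ) (U : Set B) : Prop :=
  ∀ (e : InteriorChart n B) (η : 𝓓(e.range, ℝ)), (∀ z ∈ tsupport η, e.symm z ∈ U) →
    u.toFun e η = ∫ z in (e.range : Set (E (n + 1))), (η z : ℂ) * f (e.symm z)

/-- The compatibility of u transports a test function from any chart to `e`, and the change of
variables formula transports the integral by the same Jacobian. Hence a single chart suffices. -/
theorem InteriorDistribution.isGivenOn_of_chart {u : InteriorDistribution n B} {f : B → ℂ}
    {U : Set B} (e : InteriorChart n B) (hU : U ⊆ e.source)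
    (h : ∀ η : 𝓓(e.range, ℝ), (∀ z ∈ tsupport η, e.symm z ∈ U) →
      u.toFun e η = ∫ z in (e.range : Set (E (n + 1))), (η z : ℂ) * f (e.symm z)) :
    u.IsGivenOn f U := by
  intro e' η' hη'
  set τ := e.transition e' with hτ
  have ht : tsupport η' ⊆ τ.target := fun z hz =>
    (e.mem_transition_target e').2 ⟨η'.tsupport_subset hz, hU (hη' z hz)⟩
  obtain ⟨η, hs, hη⟩ := e.exists_testFunction_transition e' η' ht
  have hs' : tsupport η ⊆ τ.source := hs.trans <| by
    rintro _ ⟨w, hw, rfl⟩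
    exact τ.map_target (ht hw)
  rw [← u.compat e e' η η' hs' ht hη, h η]
  · have hsub : τ.source ⊆ e.range := fun z hz => ((e.mem_transition_source e').1 hz).1
    have hsub' : τ.target ⊆ e'.range := fun z hz => ((e.mem_transition_target e').1 hz).1
    have e1 := setIntegral_eq_of_subset_of_forall_sdiff_eq_zero (μ := volume)
      (f := fun z => (η z : ℂ) * f (e.symm z)) e.range.isOpen.measurableSet hsub fun z hz => by
        rw [image_eq_zero_of_notMem_tsupport (f := η) fun h => hz.2 (hs' h)]
        simp
    have e2 := setIntegral_eq_of_subset_of_forall_sdiff_eq_zero (μ := volume)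
      (f := fun z => (η' z : ℂ) * f (e'.symm z)) e'.range.isOpen.measurableSet hsub' fun z hz => by
        rw [image_eq_zero_of_notMem_tsupport (f := η') fun h => hz.2 (ht h)]
        simp
    have hd : ∀ z ∈ τ.source, HasFDerivWithinAt τ (fderiv ℝ τ z) τ.source z := fun z hz =>
      (((e.contDiffOn_transition e').contDiffAt
        (τ.open_source.mem_nhds hz)).differentiableAt (by simp)).hasFDerivAt.hasFDerivWithinAt
    rw [e1, e2, ← τ.image_source_eq_target, integral_image_eq_integral_abs_det_fderiv_smul volume
        τ.open_source.measurableSet hd τ.injOn]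
    refine setIntegral_congr_fun τ.open_source.measurableSet fun z hz => ?_
    change (η z : ℂ) * f (e.symm z) =
      |(fderiv ℝ τ z).det| • ((η' (τ z) : ℂ) * f (e'.symm (τ z)))
    rw [hη z hz, e.symm_transition e' hz, Complex.real_smul]
    push_cast
    ring
  · intro z hz
    obtain ⟨w, hw, rfl⟩ := hs hz
    have := e.symm_transition e' (τ.map_target (ht hw))
    rw [← hτ, τ.right_inv (ht hw)] at this
    rw [← this]
    exact hη' w hw

/-- In the chart `e` both densities have the same integrals against test functions supported over
the overlap, and continuity upgrades this to pointwise equality. -/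
theorem InteriorDistribution.IsGivenOn.eq_of_mem {u : InteriorDistribution n B} {f f' : B → ℂ}
    {U U' : Set B} (hf : u.IsGivenOn f U) (hf' : u.IsGivenOn f' U') (hU : IsOpen U)
    (hU' : IsOpen U') (hc : ContinuousOn f U) (hc' : ContinuousOn f' U') (e : InteriorChart n B)
    {b : B} (hb : b ∈ U) (hb' : b ∈ U') (hbe : b ∈ e.source) : f b = f' b := by
  have hW : IsOpen (e.target ∩ e.symm ⁻¹' (U ∩ U')) :=
    e.toOpenPartialHomeomorph.isOpen_inter_preimage_symm (hU.inter hU')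
  have hsymm : ContinuousOn e.symm (e.target ∩ e.symm ⁻¹' (U ∩ U')) :=
    e.toOpenPartialHomeomorph.continuousOn_symm.mono inter_subset_left
  have h := eqOn_of_integral_contDiff_mul_eq hW (f := f ∘ e.symm) (g := f' ∘ e.symm)
    (hc.comp hsymm fun z hz => hz.2.1) (hc'.comp hsymm fun z hz => hz.2.2) fun φ h1 h2 h3 => by
      let η : 𝓓(e.range, ℝ) := ⟨φ, h1, h2, h3.trans inter_subset_left⟩
      have e1 := hf e η fun z hz => (h3 hz).2.1
      have e2 := hf' e η fun z hz => (h3 hz).2.2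
      rw [e1] at e2
      rw [setIntegral_eq_of_subset_of_forall_sdiff_eq_zero e.range.isOpen.measurableSet
          (s := e.target ∩ e.symm ⁻¹' (U ∩ U')) inter_subset_left,
        setIntegral_eq_of_subset_of_forall_sdiff_eq_zero e.range.isOpen.measurableSet
          (s := e.target ∩ e.symm ⁻¹' (U ∩ U')) inter_subset_left] at e2
      · exact e2
      all_goals
        intro z hz
        rw [image_eq_zero_of_notMem_tsupport (f := η) fun h => hz.2 (h3 h)]
        simp
  have hm : e.toOpenPartialHomeomorph b ∈ e.target ∩ e.symm ⁻¹' (U ∩ U') := by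
    refine ⟨e.map_source hbe, ?_⟩
    rw [mem_preimage, e.left_inv hbe]
    exact ⟨hb, hb'⟩
  have := h hm
  simp only [Function.comp_apply] at this
  rwa [e.left_inv hbe] at this

/-- A test function has compact support, so a finite partition of unity splits it into pieces, each
living over one `U i`; linearity reassembles them. -/
theorem InteriorDistribution.isGivenBy_of_cover {u : InteriorDistribution n B} {f : B → ℂ}
    {I : Type*} {U : I → Set B} (hU : ∀ i, IsOpen (U i))
    (hcov : (𝓡∂ (n + 1)).interior B ⊆ ⋃ i, U i) (hf : ∀ i, u.IsGivenOn f (U i))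
    (hc : ContinuousOn f ((𝓡∂ (n + 1)).interior B)) : u.IsGivenBy f := by
  intro e η
  have hK : IsCompact (tsupport η) := η.hasCompactSupport
  have hVo : ∀ i, IsOpen (e.target ∩ e.symm ⁻¹' U i) := fun i =>
    e.toOpenPartialHomeomorph.isOpen_inter_preimage_symm (hU i)
  have hint : ∀ z ∈ e.target, e.symm z ∈ (𝓡∂ (n + 1)).interior B := fun z hz =>
    e.source_subset (e.map_target hz)
  obtain ⟨t, ht⟩ := hK.elim_finite_subcover _ hVo fun z hz => by
    obtain ⟨i, hi⟩ := mem_iUnion.1 (hcov (hint z (η.tsupport_subset hz)))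
    exact mem_iUnion.2 ⟨i, η.tsupport_subset hz, hi⟩
  obtain ⟨ρ, hρ⟩ := SmoothPartitionOfUnity.exists_isSubordinate 𝓘(ℝ, E (n + 1)) hK.isClosed
    (fun i : t => e.target ∩ e.symm ⁻¹' U i) (fun i => hVo i) (by
      intro z hz
      obtain ⟨i, hi, hz'⟩ := mem_iUnion₂.1 (ht hz)
      exact mem_iUnion.2 ⟨⟨i, hi⟩, hz'⟩)
  let ηi : t → 𝓓(e.range, ℝ) := fun i =>
    ⟨fun z => ρ i z * η z, (ρ i).contMDiff.contDiff.mul η.contDiff,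
      η.hasCompactSupport.mul_left,
      (tsupport_mul_subset_right (f := fun z => ρ i z) (g := η)).trans η.tsupport_subset⟩
  have hηi : ∀ i z, ηi i z = ρ i z * η z := fun i z => rfl
  -- Evaluation at a point is additive, hence commutes with finite sums of test functions.
  have heval : ∀ z, (∑ i, ηi i) z = ∑ i, ηi i z := fun z =>
    map_sum (⟨⟨fun g : 𝓓(e.range, ℝ) => g z, rfl⟩, fun _ _ => rfl⟩ : 𝓓(e.range, ℝ) →+ ℝ) _ _
  have hsum : η = ∑ i, ηi i := by
    ext z
    rw [heval]
    simp only [hηi, ← Finset.sum_mul]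
    by_cases hz : z ∈ tsupport η
    · rw [← finsum_eq_sum_of_fintype, ρ.sum_eq_one hz, one_mul]
    · rw [image_eq_zero_of_notMem_tsupport hz, mul_zero]
  have hfs : ContinuousOn (fun z => f (e.symm z)) e.target :=
    hc.comp e.toOpenPartialHomeomorph.continuousOn_symm hint
  have hI : ∀ i, u.toFun e (ηi i) =
      ∫ z in (e.range : Set (E (n + 1))), (ηi i z : ℂ) * f (e.symm z) := fun i =>
    hf i e (ηi i) fun z hz =>
      (hρ i (tsupport_mul_subset_left (f := fun z => ρ i z) (g := η) hz)).2
  have hS : u.toFun e η = ∑ i, u.toFun e (ηi i) := by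
    conv_lhs => rw [hsum]
    exact map_sum (u.toFun e) _ _
  rw [hS]
  simp only [hI]
  rw [← integral_finsetSum _ fun i _ => integrableOn_testFunction_mul (ηi i)
    (f := fun z => f (e.symm z)) fun K _ hKs => hfs.mono (hKs.trans (ηi i).tsupport_subset)]
  refine setIntegral_congr_fun e.range.isOpen.measurableSet fun z _ => ?_
  have e1 : η z = ∑ i, ηi i z := by
    conv_lhs => rw [hsum]
    exact heval z
  change ∑ i, (ηi i z : ℂ) * f (e.symm z) = (η z : ℂ) * f (e.symm z)
  rw [e1, Complex.ofReal_sum, Finset.sum_mul]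

end Charts

/-! ### Continuity in the interior and pointwise estimates -/

section Embedding

variable {n : ℕ} {B : Type*} [TopologicalSpace B] [ChartedSpace (EuclideanHalfSpace (n + 1)) B]

/-- If w · u has density g, then testing u against wφ amounts to integrating φ g: the weight is
smooth, so it can be absorbed into the test function. -/
theorem IsWeightedLocalization.exists_toFun_eq {u : InteriorDistribution n B}
    {e : InteriorChart n B} {w : E (n + 1) → ℝ} {T : 𝓢'(E (n + 1), ℂ)}
    (h : IsWeightedLocalization u e w T) (hw : ContDiffOn ℝ ∞ w e.range) {g : E (n + 1) → ℂ}
    (hg : ∀ φ : 𝓢(E (n + 1), ℂ), T φ = ∫ z, φ z * g z) (φ : 𝓓(e.range, ℝ)) :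
    ∃ η : 𝓓(e.range, ℝ), (∀ z ∈ e.range, η z = w z * φ z) ∧
      u.toFun e η = ∫ z in (e.range : Set (E (n + 1))), (φ z : ℂ) * g z := by
  have h0 : ∀ z ∈ (e.range : Set (E (n + 1))), z ∉ tsupport φ → w z * φ z = 0 := fun z _ hz => by
    rw [image_eq_zero_of_notMem_tsupport hz, mul_zero]
  have hs : ContDiffOn ℝ ∞ (fun z => w z * φ z) e.range := hw.mul φ.contDiff.contDiffOn
  let η : 𝓓(e.range, ℝ) := testFunctionOfIndicator e.range.isOpen φ.hasCompactSupport
    φ.tsupport_subset φ.tsupport_subset _ hs h0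
  have hη : ∀ z ∈ e.range, η z = w z * φ z := fun z hz =>
    testFunctionOfIndicator_apply _ _ _ _ _ _ _ hz
  refine ⟨η, hη, ?_⟩
  have hc : HasCompactSupport fun z => (φ z : ℂ) :=
    φ.hasCompactSupport.comp_left (g := fun r : ℝ => (r : ℂ)) Complex.ofReal_zero
  have hsm : ContDiff ℝ ∞ fun z => (φ z : ℂ) := Complex.ofRealCLM.contDiff.comp φ.contDiff
  have h1 := h (hc.toSchwartzMap hsm) hc η fun z hz => by
    rw [hη z hz, HasCompactSupport.toSchwartzMap_toFun]
    push_cast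
    rfl
  rw [← h1, hg, setIntegral_eq_integral_of_forall_compl_eq_zero fun z hz => ?_]
  · rfl
  · rw [image_eq_zero_of_notMem_tsupport (f := φ) fun h => hz (φ.tsupport_subset h)]
    simp

theorem finrank_div_lt {p : ℝ≥0∞} {s : ℝ} (hs : ((n : ℝ) + 1) / p.toReal < s) :
    Module.finrank ℝ (E (n + 1)) / p.toReal < s := by
  simpa using hs

/-- The pointwise estimate in a chart. -/
theorem norm_weight_mul_le {u : InteriorDistribution n B} {f : B → ℂ} (hf : u.IsGivenBy f)
    (hc : ContinuousOn f ((𝓡∂ (n + 1)).interior B)) {e : InteriorChart n B} {w : E (n + 1) → ℝ}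
    (hw : ContDiffOn ℝ ∞ w e.range) {s : ℝ} {p : ℝ≥0∞} [Fact (1 ≤ p)] (hp : p ≠ ⊤)
    (hs : ((n : ℝ) + 1) / p.toReal < s) (hm : MemSobolevInChart s p u e w) {z : E (n + 1)}
    (hz : z ∈ e.target) :
    ‖(w z : ℂ) * f (e.symm z)‖ ≤
      besselConst (E (n + 1)) s p * sobolevNormInChart s p u e w := by
  have hs0 : 0 < s := lt_of_le_of_lt (by positivity) hs
  -- The constant is moved inside the infimum, so that the bound need only be proved for each
  -- admissible representative.
  rw [sobolevNormInChart, ← smul_eq_mul (besselConst (E (n + 1)) s p),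
    ← Real.sInf_smul_of_nonneg (besselConst_nonneg (V := E (n + 1)) hs0 p)]
  refine le_csInf ?_ ?_
  -- Membership makes the set nonempty; the real infimum of the empty set would be 0 by default.
  · obtain ⟨T, hT, f', hf'⟩ := hm
    exact ⟨_, _, ⟨T, f', hT, hf', rfl⟩, rfl⟩
  · rintro _ ⟨_, ⟨T, f', hT, hf', rfl⟩, rfl⟩
    obtain ⟨g, hgc, hgle, hgT⟩ :=
      exists_continuous_of_besselPotential_eq hp (finrank_div_lt hs) hf'
    have hfe : ContinuousOn (fun z => (w z : ℂ) * f (e.symm z)) e.range :=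
      (Complex.continuous_ofReal.comp_continuousOn hw.continuousOn).mul
        (hc.comp e.toOpenPartialHomeomorph.continuousOn_symm fun z hz =>
          e.source_subset (e.map_target hz))
    have h := eqOn_of_integral_contDiff_mul_eq e.range.isOpen hfe hgc.continuousOn
      fun φ h1 h2 h3 => by
        obtain ⟨η, hη, hu⟩ := hT.exists_toFun_eq hw hgT ⟨φ, h1, h2, h3⟩
        refine Eq.trans ?_ ((hf e η).symm.trans hu)
        refine setIntegral_congr_fun e.range.isOpen.measurableSet fun z hz => ?_
        have e1 : η z = w z * φ z := hη z hz
        simp only [e1]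
        push_cast
        ring
    rw [show (w z : ℂ) * f (e.symm z) = g z from h hz]
    exact hgle z

variable {Y : Type*} [TopologicalSpace Y] [ChartedSpace (E n) Y] {C : Collar n B Y}

/-- For a bump function χ equal to 1 near b, the embedding gives χu a continuous density, and u
agrees with χu where χ = 1. -/
theorem exists_isGivenOn_nhds [T2Space B] [IsManifold (𝓡∂ (n + 1)) ∞ B] (A : LocalizationData C)
    {s : ℝ} {p : ℝ≥0∞} [Fact (1 ≤ p)] (hp : p ≠ ⊤) (hs : ((n : ℝ) + 1) / p.toReal < s)
    {u : InteriorDistribution n B} (hu : MemSobolevLoc A s p u) {b : B}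
    (hb : b ∈ (𝓡∂ (n + 1)).interior B) :
    ∃ (U : Set B) (f : B → ℂ), IsOpen U ∧ b ∈ U ∧ U ⊆ (𝓡∂ (n + 1)).interior B ∧
      ContinuousOn f U ∧ u.IsGivenOn f U := by
  obtain ⟨e, he, hbe⟩ := A.intCharts_cover b hb
  obtain ⟨χ, -, hχ⟩ := (SmoothBumpFunction.nhds_basis_tsupport (I := 𝓡∂ (n + 1)) b).mem_iff.1
    (e.open_source.mem_nhds hbe)
  obtain ⟨U₀, hU₀, hU₀o, hbU₀⟩ := eventually_nhds_iff.1 χ.eventuallyEq_one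
  obtain ⟨T, hT, f', hf'⟩ := hu e he χ χ.contMDiff χ.hasCompactSupport hχ
  obtain ⟨g, hgc, -, hgT⟩ := exists_continuous_of_besselPotential_eq hp (finrank_div_lt hs) hf'
  have hw : ContDiffOn ℝ ∞ (fun z => χ (e.symm z)) e.range := by
    rw [← contMDiffOn_iff_contDiffOn]
    exact χ.contMDiff.comp_contMDiffOn e.smooth_symm
  refine ⟨e.source ∩ U₀, fun b => g (e.toOpenPartialHomeomorph b), e.open_source.inter hU₀o,
    ⟨hbe, hbU₀⟩, inter_subset_left.trans e.source_subset,
    hgc.comp_continuousOn (e.toOpenPartialHomeomorph.continuousOn.mono inter_subset_left),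
    InteriorDistribution.isGivenOn_of_chart e inter_subset_left fun η hη => ?_⟩
  obtain ⟨η', hη', hu'⟩ := hT.exists_toFun_eq hw hgT η
  -- The weight is 1 on the support of `η`, so multiplying by it changes nothing.
  have heq : η' = η := by
    ext z
    by_cases hz : z ∈ tsupport η
    · rw [hη' z (η.tsupport_subset hz), hU₀ _ (hη z hz).2, Pi.one_apply, one_mul]
    · by_cases hz' : z ∈ e.range
      · rw [hη' z hz', image_eq_zero_of_notMem_tsupport hz, mul_zero]
      · rw [image_eq_zero_of_notMem_tsupport hz,
          image_eq_zero_of_notMem_tsupport fun h => hz' (η'.tsupport_subset h)]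
  rw [← heq, hu', heq]
  refine setIntegral_congr_fun e.range.isOpen.measurableSet fun z hz => ?_
  rw [e.right_inv hz]

/-- The elements of `H^s_{p,loc}(Int B)` are continuous functions. -/
theorem exists_continuousOn_isGivenBy [T2Space B] [IsManifold (𝓡∂ (n + 1)) ∞ B]
    (A : LocalizationData C) {s : ℝ} {p : ℝ≥0∞} [Fact (1 ≤ p)] (hp : p ≠ ⊤)
    (hs : ((n : ℝ) + 1) / p.toReal < s) {u : InteriorDistribution n B}
    (hu : MemSobolevLoc A s p u) :
    ∃ f : B → ℂ, ContinuousOn f ((𝓡∂ (n + 1)).interior B) ∧ u.IsGivenBy f := by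
  classical
  choose U F hUo hbU hUi hFc hF using
    fun b : (𝓡∂ (n + 1)).interior B => exists_isGivenOn_nhds A hp hs hu b.2
  -- At b the value is that of the density selected at b itself; by uniqueness it coincides with
  -- every other local density defined at b. The value 0 on the boundary is arbitrary.
  let f : B → ℂ := fun b => if hb : b ∈ (𝓡∂ (n + 1)).interior B then F ⟨b, hb⟩ b else 0
  have hfF : ∀ b, EqOn f (F b) (U b) := by
    intro b b' hb'
    have hi := hUi b hb'
    obtain ⟨e, -, hbe⟩ := A.intCharts_cover b' hi
    simp only [f, dif_pos hi]
    exact (hF ⟨b', hi⟩).eq_of_mem (hF b) (hUo _) (hUo _) (hFc _) (hFc _) e (hbU ⟨b', hi⟩) hb' hbe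
  have hfc : ContinuousOn f ((𝓡∂ (n + 1)).interior B) := fun b hb =>
    (((hFc ⟨b, hb⟩).congr (hfF ⟨b, hb⟩)).continuousAt
      ((hUo ⟨b, hb⟩).mem_nhds (hbU ⟨b, hb⟩))).continuousWithinAt
  refine ⟨f, hfc, InteriorDistribution.isGivenBy_of_cover hUo
    (fun b hb => mem_iUnion.2 ⟨⟨b, hb⟩, hbU ⟨b, hb⟩⟩) (fun b e η hη => ?_) hfc⟩
  rw [hF b e η hη]
  refine setIntegral_congr_fun e.range.isOpen.measurableSet fun z _ => ?_
  by_cases hz : z ∈ tsupport η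
  · simp only [hfF b (hη z hz)]
  · simp [image_eq_zero_of_notMem_tsupport hz]

theorem contDiffOn_collarWeight (A : LocalizationData C) (γ : ℝ) {θ : ℝ → ℝ} (hθ : IsCutoff θ)
    (i : A.ι) : ContDiffOn ℝ ∞ (A.collarWeight γ θ i) (A.collarChart i).range := by
  have h0 : ContDiff ℝ ∞ fun w : E (n + 1) => w 0 := by fun_prop
  have h1 : ContDiff ℝ ∞ fun w : E (n + 1) => Real.exp ((γ - ((n : ℝ) + 1) / 2) * w 0) :=
    (contDiff_const.mul h0).exp
  have h2 : ContDiff ℝ ∞ fun w : E (n + 1) => θ (Real.exp (-w 0)) := hθ.smooth.comp h0.neg.exp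
  have h3 : ContDiffOn ℝ ∞ (fun w : E (n + 1) => A.part i ((A.bdryChart i).symm (tailE w)))
      (A.collarChart i).range := by
    rw [← contMDiffOn_iff_contDiffOn]
    exact (A.part_smooth i).comp_contMDiffOn
      ((contMDiffOn_symm_of_mem_maximalAtlas (A.bdryChart_mem i)).comp
        (contDiff_tailE (n := n)).contMDiff.contMDiffOn fun z hz => hz.2)
  exact (h1.mul h2).contDiffOn.mul h3

theorem sobolevNormInChart_nonneg (s : ℝ) (p : ℝ≥0∞) [Fact (1 ≤ p)]
    (u : InteriorDistribution n B) (e : InteriorChart n B) (w : E (n + 1) → ℝ) :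
    0 ≤ sobolevNormInChart s p u e w := by
  refine Real.sInf_nonneg ?_
  rintro _ ⟨T, f, -, -, rfl⟩
  exact norm_nonneg _

/-- The pointwise estimate near the boundary, where the cut-off function is `1`. -/
theorem norm_point_le (A : LocalizationData C) {s : ℝ} (γ : ℝ) {p : ℝ≥0∞} [Fact (1 ≤ p)]
    (hp : p ≠ ⊤) (hs : ((n : ℝ) + 1) / p.toReal < s) {u : InteriorDistribution n B}
    (hu : MemSobolevCylinder A s γ p A.θ u) {f : B → ℂ} (hf : u.IsGivenBy f)
    (hc : ContinuousOn f ((𝓡∂ (n + 1)).interior B)) {x : ℝ} (hx : 0 < x) (hx1 : x < 1)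
    (hθ : A.θ x = 1) (y : Y) :
    ‖f (C.point x y)‖ ≤ besselConst (E (n + 1)) s p * x ^ (γ - ((n : ℝ) + 1) / 2) *
      coneSobolevNorm A s γ p u := by
  set a : ℝ := γ - ((n : ℝ) + 1) / 2 with ha
  set K : ℝ := besselConst (E (n + 1)) s p with hK
  set N : A.ι → ℝ := fun i =>
    sobolevNormInChart s p u (A.collarChart i) (A.collarWeight γ A.θ i) with hN
  have hK0 : 0 ≤ K := besselConst_nonneg (lt_of_le_of_lt (by positivity) hs) p
  have hN0 : ∀ i, 0 ≤ N i := fun i => sobolevNormInChart_nonneg _ _ _ _ _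
  have hi : ∀ i, A.part i y * ‖f (C.point x y)‖ ≤ x ^ a * (K * N i) := by
    intro i
    -- Where the partition function vanishes, y may lie outside the chart, but then the left side is
    -- 0.
    by_cases hpart : A.part i y = 0
    · rw [hpart, zero_mul]
      have := hN0 i
      positivity
    have hy : y ∈ (A.bdryChart i).source := A.part_tsupport i (subset_tsupport _ hpart)
    set z : E (n + 1) := consE (-Real.log x) (A.bdryChart i y) with hz
    have hzt : z ∈ (A.collarChart i).target := by
      change 0 < z 0 ∧ tailE z ∈ (A.bdryChart i).target
      rw [hz, consE_zero, tailE_consE]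
      exact ⟨neg_pos.2 (Real.log_neg hx hx1), (A.bdryChart i).map_source hy⟩
    have hzs : (A.collarChart i).symm z = C.point x y := by
      change C.point (Real.exp (-z 0)) ((A.bdryChart i).symm (tailE z)) = _
      rw [hz, consE_zero, tailE_consE, neg_neg, Real.exp_log hx, (A.bdryChart i).left_inv hy]
    -- At r = -log x the factor e^{ar} is x^{-a}, and the cut-off is 1.
    have hwz : A.collarWeight γ A.θ i z = (x ^ a)⁻¹ * A.part i y := by
      rw [LocalizationData.collarWeight, hz, consE_zero, tailE_consE, neg_neg, Real.exp_log hx,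
        (A.bdryChart i).left_inv hy, hθ, ← ha, ← Real.rpow_neg hx.le, Real.rpow_def_of_pos hx]
      ring_nf
    have h := norm_weight_mul_le hf hc (contDiffOn_collarWeight A γ A.θ_cutoff i) hp hs (hu i) hzt
    have hxa : 0 < x ^ a := Real.rpow_pos_of_pos hx a
    rw [hzs, hwz, norm_mul, Complex.norm_real,
      Real.norm_of_nonneg (mul_nonneg (inv_nonneg.2 hxa.le) (A.part_nonneg i y)), mul_assoc,
      inv_mul_le_iff₀ hxa] at h
    exact h
  have hsum := Finset.sum_le_sum fun i (_ : i ∈ Finset.univ) => hi i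
  rw [← Finset.sum_mul, A.part_sum, one_mul, ← Finset.mul_sum, ← Finset.mul_sum] at hsum
  refine hsum.trans ?_
  rw [← mul_assoc, mul_comm (x ^ a)]
  refine mul_le_mul_of_nonneg_left ?_ (by positivity)
  -- The interior part of the norm is nonnegative and is not needed.
  exact le_add_of_nonneg_right (Finset.sum_nonneg fun j _ => sobolevNormInChart_nonneg _ _ _ _ _)

end Embedding

end ConeSobolev

end

/-! ### The estimate near the boundary and the decay -/

theorem corollary2p6 {n : ℕ}
    {B : Type*} [TopologicalSpace B] [T2Space B] [CompactSpace B]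
    [ChartedSpace (EuclideanHalfSpace (n + 1)) B] [IsManifold (𝓡∂ (n + 1)) ∞ B]
    {Y : Type*} [TopologicalSpace Y] [T2Space Y] [CompactSpace Y]
    [ChartedSpace (EuclideanSpace ℝ (Fin n)) Y] [IsManifold (𝓡 n) ∞ Y]
    (C : Collar n B Y) (A : LocalizationData C)
    (p : ℝ≥0∞) [Fact (1 ≤ p)] (hp : p ≠ ⊤) (s γ : ℝ) (hs : ((n : ℝ) + 1) / p.toReal < s) :
    ∃ c δ : ℝ, 0 ≤ c ∧ 0 < δ ∧ δ < 1 ∧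
      ∀ u : InteriorDistribution n B, MemConeSobolev A s γ p u →
        ∃ f : B → ℂ, ContinuousOn f ((𝓡∂ (n + 1)).interior B) ∧ u.IsGivenBy f ∧
          (∀ x ∈ Ioo (0 : ℝ) δ, ∀ y : Y,
            ‖f (C.point x y)‖ ≤ c * x ^ (γ - ((n : ℝ) + 1) / 2) * coneSobolevNorm A s γ p u) ∧
          (((n : ℝ) + 1) / 2 < γ →
            TendstoUniformly (fun (x : ℝ) (y : Y) => f (C.point x y)) (fun _ => 0)
              (𝓝[>] (0 : ℝ))) := by
  obtain ⟨ε, hε, hθ⟩ := A.θ_cutoff.eq_one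
  have hK0 : 0 ≤ besselConst (E (n + 1)) s p :=
    besselConst_nonneg (lt_of_le_of_lt (by positivity) hs) p
  -- The bound ε keeps x where the cut-off of the norm equals 1; 1/2 ensures δ < 1. Neither depends
  -- on u.
  have hδ : 0 < min ε (1 / 2) := by positivity
  refine ⟨besselConst (E (n + 1)) s p, min ε (1 / 2), hK0, hδ,
    (min_le_right _ _).trans_lt (by norm_num), fun u hu => ?_⟩
  obtain ⟨f, hfc, hf⟩ := exists_continuousOn_isGivenBy A hp hs hu.1
  have hbound : ∀ x ∈ Ioo (0 : ℝ) (min ε (1 / 2)), ∀ y : Y, ‖f (C.point x y)‖ ≤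
      besselConst (E (n + 1)) s p * x ^ (γ - ((n : ℝ) + 1) / 2) * coneSobolevNorm A s γ p u := by
    intro x hx y
    have h1 : x < 1 / 2 := hx.2.trans_le (min_le_right _ _)
    exact norm_point_le A γ hp hs (hu.2 A.θ A.θ_cutoff) hf hfc hx.1 (by linarith)
      (hθ x (hx.2.le.trans (min_le_left _ _))) y
  refine ⟨f, hfc, hf, hbound, fun hγ => ?_⟩
  rw [Metric.tendstoUniformly_iff]
  intro r hr
  have ha : 0 < γ - ((n : ℝ) + 1) / 2 := sub_pos.2 hγ
  have ht : Tendsto (fun x : ℝ => besselConst (E (n + 1)) s p * x ^ (γ - ((n : ℝ) + 1) / 2) *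
      coneSobolevNorm A s γ p u) (𝓝[>] 0) (𝓝 0) := by
    -- A positive exponent makes x^a continuous at 0 with value 0.
    have h1 := (Real.continuousAt_rpow_const 0 (γ - ((n : ℝ) + 1) / 2) (Or.inr ha.le)).tendsto
    rw [Real.zero_rpow ha.ne'] at h1
    have h2 := ((h1.mono_left (nhdsWithin_le_nhds (s := Ioi 0))).const_mul
      (besselConst (E (n + 1)) s p)).mul_const (coneSobolevNorm A s γ p u)
    simpa using h2
  filter_upwards [ht.eventually_lt_const hr, Ioo_mem_nhdsGT hδ] with x hx hx' y
  rw [dist_zero_left]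
  exact (hbound x hx' y).trans_lt hx
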